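/- A Polish space is a separable, completely metrizable topological space; a Polish group is a topological group whose underlying space is Polish; a standard Borel space is a measurable space whose $\sigma$-algebra is the Borel $\sigma$-algebra of some Polish topology. Let $G$ be a Polish group. A Polish $G$-space is a Polish space $X$ with an action of $G$ that is continuous as a map $G\times X\to X$. A Borel $G$-space is a standard Borel space $X$ with an action of $G$ that is Borel as a map $G\times X\to X$. A perfect set is a nonempty closed set without isolated points, and "countable" means finite or countably infinite. Consider the following statements. $\mathrm{TVC}_{I}(G)$: for every Polish $G$-space $X$ and every invariant Borel set $B\subseteq X$, either $B$ contains only countably many orbits, or there is a perfect set $P\subseteq B$ (closed in $X$) such that any two distinct members of $P$ belong to different orbits. $\mathrm{TVC}_{II}(G)$: for every Polish $G$-space $X$, either $X$ contains only countably many orbits, or there is a perfect set $P\subseteq X$ such that any two distinct members of $P$ belong to different orbits. $\mathrm{TVC}_{III}(G)$: for every Borel $G$-space $X$, either $X$ contains only countably many orbits, or there is an uncountable Borel set $P\subseteq X$ such that any two distinct members of $P$ belong to different orbits. **Corollary 1.3.** For every Polish group $G$, the statements $\mathrm{TVC}_{I}(G)$, $\mathrm{TVC}_{II}(G)$ and $\mathrm{TVC}_{III}(G)$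 are equivalent. -/

import Mathlib

universe u v

namespace Vaught

/-- The collection of orbits (as subsets of `X`) of the points of `B` under the action of `G`.
When `B` is invariant these are precisely the orbits contained in `B`. -/
def orbitsOf (G : Type*) {X : Type*} [Group G] [MulAction G X] (B : Set X) : Set (Set X) :=
  {O | ∃ x ∈ B, O = MulAction.orbit G x}

/-- `B` is invariant under the action of `G`. -/
def IsInvariant (G : Type*) {X : Type*} [Group G] [MulAction G X] (B : Set X) : Prop :=
  ∀ g : G, ∀ x ∈ B, g • x ∈ B

/-- Any two distinct members of `P` belong to different orbits. -/
def OrbitInequivalent (G : Type*) {X : Type*} [Group G] [MulAction G X] (P : Set X) : Prop :=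
  ∀ x ∈ P, ∀ y ∈ P, x ≠ y → MulAction.orbit G x ≠ MulAction.orbit G y

/-- First form: for every Polish `G`-space `X` and every invariant Borel set `B ⊆ X`, either `B`
contains countably many orbits, or there is a (nonempty) perfect set `P ⊆ B` any two distinct
members of which lie in different orbits. Here `Perfect P` means closed without isolated points. -/
def TVC_I (G : Type u) [Group G] [TopologicalSpace G] : Prop :=
  ∀ (X : Type v) [TopologicalSpace X] [PolishSpace X] [MeasurableSpace X] [BorelSpace X]
    [MulAction G X] [ContinuousSMul G X] (B : Set X),
    MeasurableSet B → IsInvariant G B →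
      (orbitsOf G B).Countable ∨
        ∃ P : Set X, P ⊆ B ∧ P.Nonempty ∧ Perfect P ∧ OrbitInequivalent G P

/-- Second form: for every Polish `G`-space `X`, either `X` contains countably many orbits, or there
is a (nonempty) perfect set `P ⊆ X` any two distinct members of which lie in different orbits. -/
def TVC_II (G : Type u) [Group G] [TopologicalSpace G] : Prop :=
  ∀ (X : Type v) [TopologicalSpace X] [PolishSpace X] [MulAction G X] [ContinuousSMul G X],
    (orbitsOf G (Set.univ : Set X)).Countable ∨
      ∃ P : Set X, P.Nonempty ∧ Perfect P ∧ OrbitInequivalent G P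

/-- Third form: for every Borel `G`-space `X` (a standard Borel space with an action of `G` that is
Borel as a map `G × X → X`), either `X` contains countably many orbits, or there is an uncountable
Borel set `P ⊆ X` any two distinct members of which lie in different orbits. -/
def TVC_III (G : Type u) [Group G] [MeasurableSpace G] : Prop :=
  ∀ (X : Type v) [MeasurableSpace X] [StandardBorelSpace X] [MulAction G X] [MeasurableSMul₂ G X],
    (orbitsOf G (Set.univ : Set X)).Countable ∨
      ∃ P : Set X, MeasurableSet P ∧ ¬ P.Countable ∧ OrbitInequivalent G P

end Vaught

open Set Filter Topology MeasureTheory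

namespace Vaught

/-! I implies II by taking the whole space. III implies I because an invariant Borel set is itself a
Borel `G`-space and an uncountable Borel set contains a perfect one (`exists_perfect_subset`). The
weight lies in II implies III, which needs the Becker–Kechris theorem: a Borel `G`-space carries a
compatible Polish topology with continuous action.

For that, fix a right-invariant pseudometric on `G`. The 1-Lipschitz functions `G → [0, 1]` form a
compact Polish `G`-space under right translation. For Borel `A`, `vaughtMap A x` records where `{k |
k • x ∈ A}` is nonmeagre; it is equivariant and Borel in `x`. A countable separating family of sets
`A` gives an equivariant Borel injection of `X` into a Polish `G`-space, with invariant Borel range.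
Such a range becomes open in a finer Polish `G`-topology (`exists_finer_isOpen_of_isInvariant`),
which is pulled back to `X`. -/

theorem polishSpace_of_isGδ {α : Type*} [TopologicalSpace α] [PolishSpace α] {s : Set α}
    (hs : IsGδ s) : PolishSpace s := by
  obtain ⟨O, hO, rfl⟩ := isGδ_iff_eq_iInter_nat.1 hs
  have hP : ∀ n, PolishSpace (O n) := fun n => (hO n).polishSpace
  -- The diagonal embedding into a product of Polish spaces; its image is closed, being cut out by
  -- equality of coordinates.
  let f : (⋂ n, O n : Set α) → ∀ n, O n := fun x n => ⟨x.1, mem_iInter.1 x.2 n⟩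
  have hf : Continuous f := by fun_prop
  have hr : range f = {y | ∀ n, (y n : α) = y 0} := by
    ext y
    constructor
    · rintro ⟨x, rfl⟩ n
      rfl
    · intro hy
      refine ⟨⟨y 0, mem_iInter.2 fun n => hy n ▸ (y n).2⟩, ?_⟩
      funext n
      exact Subtype.ext (hy n).symm
  have hind : IsInducing f := by
    refine IsInducing.of_comp hf (g := fun y => (y 0 : α)) (by fun_prop) ?_
    exact IsInducing.subtypeVal
  refine IsClosedEmbedding.polishSpace (f := f)
    ⟨⟨hind, fun x y h => Subtype.ext (congrArg (fun z => (z 0 : α)) h)⟩, ?_⟩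
  rw [hr, ofPred_forall]
  exact isClosed_iInter fun n => isClosed_eq (by fun_prop) (by fun_prop)

/-! ### Right-invariant pseudometrics -/

/-- Birkhoff–Kakutani, for right-invariant pseudometrics. -/
theorem exists_rightInvariant_pseudoMetricSpace (G : Type*) [Group G] [t : TopologicalSpace G]
    [IsTopologicalGroup G] [FirstCountableTopology G] :
    ∃ I : PseudoMetricSpace G, I.toUniformSpace.toTopologicalSpace = t ∧
      ∀ x y g : G, dist (x * g) (y * g) = dist x y := by
  let := IsTopologicalGroup.rightUniformSpace G
  have hunif : uniformity G = comap (fun x : G × G => x.2 * x.1⁻¹) (𝓝 1) :=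
    rfl
  have : (uniformity G).IsCountablyGenerated := by
    rw [hunif]
    infer_instance
  let I₀ : PseudoMetricSpace G := UniformSpace.pseudoMetricSpace G
  -- The supremum over right translates forces invariance; truncation keeps it finite. The topology
  -- survives because `x * y⁻¹`, which controls the right uniformity, is unchanged by right
  -- translation.
  let d : G → G → ℝ := fun x y => ⨆ g, min 1 (dist (x * g) (y * g))
  have hbdd : ∀ x y, BddAbove (range fun g : G => min 1 (dist (x * g) (y * g))) := fun x y =>
    ⟨1, by rintro _ ⟨g, rfl⟩; exact min_le_left _ _⟩
  have hle : ∀ x y g, min 1 (dist (x * g) (y * g)) ≤ d x y := fun x y g => le_ciSup (hbdd x y) g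
  let I : PseudoMetricSpace G :=
    { dist := d
      dist_self := fun x => by simp [d]
      dist_comm := fun x y => by simp [d, dist_comm]
      dist_triangle := fun x y z => by
        refine ciSup_le fun g => ?_
        have h := dist_triangle (x * g) (y * g) (z * g)
        have h1 := hle x y g
        have h2 := hle y z g
        have h3 : min 1 (dist (x * g) (z * g)) ≤
            min 1 (dist (x * g) (y * g)) + min 1 (dist (y * g) (z * g)) := by
          have := dist_nonneg (x := x * g) (y := y * g)
          have := dist_nonneg (x := y * g) (y := z * g)
          rcases min_cases 1 (dist (x * g) (z * g)) with h4 | h4 <;>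
          rcases min_cases 1 (dist (x * g) (y * g)) with h5 | h5 <;>
          rcases min_cases 1 (dist (y * g) (z * g)) with h6 | h6 <;> linarith
        linarith }
  refine ⟨I, ?_, fun x y g => ?_⟩
  · refine TopologicalSpace.ext_nhds fun x => ?_
    refine (@Metric.nhds_basis_ball G I x).ext (@Metric.nhds_basis_ball G I₀ x) ?_ ?_
    · intro ε hε
      have hm : {p : G × G | @dist G I₀.toDist p.1 p.2 < ε / 2} ∈ uniformity G :=
        @Metric.dist_mem_uniformity G I₀ _ (half_pos hε)
      rw [hunif] at hm
      obtain ⟨V, hV, hVε⟩ := mem_comap.1 hm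
      have hx : {y : G | x * y⁻¹ ∈ V} ∈ 𝓝 x :=
        (continuous_const.mul continuous_inv).continuousAt.preimage_mem_nhds (by simpa using hV)
      obtain ⟨δ, hδ, hsub⟩ := (@Metric.mem_nhds_iff G I₀ x _).1 hx
      refine ⟨δ, hδ, fun y hy => ?_⟩
      have hxy : x * y⁻¹ ∈ V := hsub hy
      change d y x < ε
      refine lt_of_le_of_lt (ciSup_le fun g => ?_) (half_lt_self hε)
      refine (min_le_right _ _).trans (le_of_lt ?_)
      exact hVε (show ((y * g, x * g) : G × G).2 * ((y * g, x * g) : G × G).1⁻¹ ∈ V by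
        simpa [mul_assoc] using hxy)
    · intro ε hε
      refine ⟨min 1 ε, lt_min one_pos hε, fun y hy => ?_⟩
      have h1 : d y x < min 1 ε := hy
      have h2 := hle y x 1
      rw [mul_one, mul_one] at h2
      have h3 := h2.trans_lt h1
      rcases min_lt_iff.1 h3 with h4 | h4
      · exact absurd (h4.trans_le (min_le_left _ _)) (lt_irrefl _)
      · exact h4.trans_le (min_le_right _ _)
  · change d (x * g) (y * g) = d x y
    simp only [d, mul_assoc]
    exact (Group.mulLeft_bijective g).surjective.iSup_comp
      (g := fun k => min 1 (@dist G I₀.toDist (x * k) (y * k)))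

/-! ### The Polish `G`-space of Lipschitz functions -/

/-- The functions `G → [0, 1]` that are `1`-Lipschitz. -/
@[ext]
structure LipFun (G : Type*) [PseudoMetricSpace G] where
  /-- The underlying function. -/
  toFun : G → ℝ
  mem_Icc : ∀ h, toFun h ∈ Icc (0 : ℝ) 1
  le_add_dist : ∀ h k, toFun h ≤ toFun k + dist h k

namespace LipFun

variable {G : Type*} [PseudoMetricSpace G]

instance : CoeFun (LipFun G) fun _ => G → ℝ := ⟨toFun⟩

/-- The topology of pointwise convergence. -/
instance : TopologicalSpace (LipFun G) := .induced toFun inferInstance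

instance : MeasurableSpace (LipFun G) := borel _

instance : BorelSpace (LipFun G) := ⟨rfl⟩

theorem isInducing_toFun : IsInducing (toFun : LipFun G → G → ℝ) := ⟨rfl⟩

theorem abs_sub_le (φ : LipFun G) (h k : G) : |φ h - φ k| ≤ dist h k := by
  have h1 := φ.le_add_dist h k
  have h2 := φ.le_add_dist k h
  rw [dist_comm k h] at h2
  rw [abs_le]
  constructor <;> linarith

protected theorem continuous (φ : LipFun G) : Continuous φ :=
  (LipschitzWith.of_le_add φ.le_add_dist).continuous

theorem continuous_eval (h : G) : Continuous fun φ : LipFun G => φ h :=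
  (continuous_apply h).comp isInducing_toFun.continuous

theorem continuous_iff {X : Type*} [TopologicalSpace X] {F : X → LipFun G} :
    Continuous F ↔ ∀ h, Continuous fun x => F x h := by
  rw [isInducing_toFun.continuous_iff, continuous_pi_iff]
  rfl

instance : CompactSpace (LipFun G) := by
  have hr : (toFun '' univ : Set (G → ℝ)) =
      {φ | (∀ h, φ h ∈ Icc (0 : ℝ) 1) ∧ ∀ h k, φ h ≤ φ k + dist h k} := by
    ext φ
    refine ⟨?_, fun h => ⟨⟨φ, h.1, h.2⟩, trivial, rfl⟩⟩
    rintro ⟨φ, -, rfl⟩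
    exact ⟨φ.mem_Icc, φ.le_add_dist⟩
  refine ⟨isInducing_toFun.isCompact_iff.2 ?_⟩
  rw [hr]
  have hI : IsClosed {φ : G → ℝ | ∀ h, φ h ∈ Icc (0 : ℝ) 1} := by
    rw [ofPred_forall]
    exact isClosed_iInter fun h => isClosed_Icc.preimage (continuous_apply h)
  have hc : IsClosed {φ : G → ℝ | ∀ h k, φ h ≤ φ k + dist h k} := by
    simp only [ofPred_forall]
    exact isClosed_iInter fun h => isClosed_iInter fun k =>
      isClosed_le (by fun_prop) (by fun_prop)
  exact (isCompact_univ_pi fun _ : G => isCompact_Icc (a := (0 : ℝ)) (b := 1)).of_isClosed_subset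
    (hI.inter hc) fun φ hφ h _ => hφ.1 h

section Separable

variable [TopologicalSpace.SeparableSpace G] [Nonempty G]

/-- The restriction of a function to a dense sequence. -/
theorem isClosedEmbedding_denseSeq :
    IsClosedEmbedding fun (φ : LipFun G) (n : ℕ) => φ (TopologicalSpace.denseSeq G n) := by
  refine Continuous.isClosedEmbedding (continuous_pi fun n => continuous_eval _) ?_
  intro φ ψ h
  have : (φ : G → ℝ) = ψ := Continuous.ext_on (TopologicalSpace.denseRange_denseSeq G)
    φ.continuous ψ.continuous (by rintro _ ⟨n, rfl⟩; exact congrFun h n)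
  exact LipFun.ext this

instance : PolishSpace (LipFun G) := isClosedEmbedding_denseSeq.polishSpace

theorem measurable_iff {X : Type*} [MeasurableSpace X] {F : X → LipFun G} :
    Measurable F ↔ ∀ h, Measurable fun x => F x h := by
  refine ⟨fun hF h => (continuous_eval h).measurable.comp hF, fun hF => ?_⟩
  rw [← isClosedEmbedding_denseSeq.measurableEmbedding.measurable_comp_iff]
  exact measurable_pi_iff.2 fun n => hF _

end Separable

variable [Group G] [IsIsometricSMul Gᵐᵒᵖ G]

instance : MulAction G (LipFun G) where
  smul g φ := ⟨fun h => φ (h * g), fun h => φ.mem_Icc _, fun h k => by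
    simpa using φ.le_add_dist (h * g) (k * g)⟩
  one_smul φ := LipFun.ext (funext fun h => congrArg φ (mul_one h))
  mul_smul g g' φ := LipFun.ext (funext fun h => congrArg φ (mul_assoc h g g').symm)

/-- The Lipschitz bound is uniform in the function, so pointwise convergence at `h * g₀` already
controls the values at nearby `h * g`. -/
instance [ContinuousMul G] : ContinuousSMul G (LipFun G) := by
  refine ⟨continuous_iff.2 fun h => ?_⟩
  rw [continuous_iff_continuousAt]
  rintro ⟨g₀, φ₀⟩
  have h1 : Tendsto (fun p : G × LipFun G => p.2 (h * g₀) - dist (h * p.1) (h * g₀))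
      (𝓝 (g₀, φ₀)) (𝓝 (φ₀ (h * g₀))) := by
    have : Continuous fun p : G × LipFun G => p.2 (h * g₀) - dist (h * p.1) (h * g₀) :=
      ((continuous_eval _).comp continuous_snd).sub (by fun_prop)
    simpa using this.tendsto (g₀, φ₀)
  have h2 : Tendsto (fun p : G × LipFun G => p.2 (h * g₀) + dist (h * p.1) (h * g₀))
      (𝓝 (g₀, φ₀)) (𝓝 (φ₀ (h * g₀))) := by
    have : Continuous fun p : G × LipFun G => p.2 (h * g₀) + dist (h * p.1) (h * g₀) :=
      ((continuous_eval _).comp continuous_snd).add (by fun_prop)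
    simpa using this.tendsto (g₀, φ₀)
  refine tendsto_of_tendsto_of_tendsto_of_le_of_le h1 h2 (fun p => ?_) fun p => ?_
  · have := (abs_le.1 (p.2.abs_sub_le (h * p.1) (h * g₀))).1
    change _ ≤ p.2 (h * p.1)
    linarith
  · have := (abs_le.1 (p.2.abs_sub_le (h * p.1) (h * g₀))).2
    change p.2 (h * p.1) ≤ _
    linarith

end LipFun


theorem polishSpace_induced_of_isGδ_range {α β : Type*} [t : TopologicalSpace β] [PolishSpace β]
    {f : α → β} (hf : Function.Injective f) (hr : IsGδ (range f)) :
    @PolishSpace α (t.induced f) := by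
  have := polishSpace_of_isGδ hr
  have h := (Equiv.ofInjective f hf).polishSpace_induced
  rwa [instTopologicalSpaceSubtype, induced_compose] at h

/-! ### Baire category coded by Lipschitz functions -/

section Category

open TopologicalSpace

variable {G : Type*} [PseudoMetricSpace G]

/-- The distance from `h` to the points near which `S` is nonmeagre, truncated at `1`. -/
noncomputable def catDist (S : Set G) (h : G) : ℝ :=
  sInf (insert 1 {r | ¬ IsMeagre (S ∩ Metric.ball h r)})

theorem nonneg_of_mem_catDist {S : Set G} {h : G} {r : ℝ}
    (hr : r ∈ insert (1 : ℝ) {r | ¬ IsMeagre (S ∩ Metric.ball h r)}) : 0 ≤ r := by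
  rcases hr with rfl | hr
  · exact zero_le_one
  · by_contra! hlt
    refine hr ?_
    rw [Metric.ball_eq_empty.2 hlt.le, inter_empty]
    exact IsMeagre.empty

/-- An open ball is a countable union of smaller concentric balls, so nonmeagreness in it already
occurs at some smaller radius. -/
theorem catDist_lt_iff {S : Set G} {h : G} {r : ℝ} :
    catDist S h < r ↔ 1 < r ∨ ¬ IsMeagre (S ∩ Metric.ball h r) := by
  rw [catDist, csInf_lt_iff ⟨0, fun _ => nonneg_of_mem_catDist⟩ ⟨1, mem_insert _ _⟩]
  constructor
  · rintro ⟨b, rfl | hb, hbr⟩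
    · exact Or.inl hbr
    · exact Or.inr fun hm => hb (hm.mono (inter_subset_inter_right _
        (Metric.ball_subset_ball hbr.le)))
  · rintro (h1 | h1)
    · exact ⟨1, mem_insert _ _, h1⟩
    · by_contra! hcon
      refine h1 (IsMeagre.mono ?_ (isMeagre_iUnion (ι' := ℕ)
        (f := fun n => S ∩ Metric.ball h (r - 1 / ((n : ℝ) + 1))) fun n => ?_))
      · rintro x ⟨hxS, hx⟩
        obtain ⟨n, hn⟩ := exists_nat_one_div_lt (sub_pos.2 (Metric.mem_ball.1 hx))
        exact mem_iUnion.2 ⟨n, hxS, Metric.mem_ball.2 (by linarith)⟩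
      · by_contra hm
        have h2 := hcon _ (mem_insert_of_mem _ hm)
        have h3 : 0 < 1 / ((n : ℝ) + 1) := by positivity
        linarith

/-- `catDist` as a Lipschitz function. -/
noncomputable def catFun (S : Set G) : LipFun G where
  toFun := catDist S
  mem_Icc h := ⟨le_csInf ⟨1, mem_insert _ _⟩ fun _ => nonneg_of_mem_catDist,
    csInf_le ⟨0, fun _ => nonneg_of_mem_catDist⟩ (mem_insert _ _)⟩
  le_add_dist h k := by
    refine le_of_forall_gt fun r hr => ?_
    rw [catDist_lt_iff]
    rcases catDist_lt_iff.1 (lt_sub_iff_add_lt.2 hr) with h1 | h1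
    · exact Or.inl (h1.trans_le (sub_le_self _ dist_nonneg))
    · refine Or.inr fun hm => h1 (hm.mono (inter_subset_inter_right _ ?_))
      exact Metric.ball_subset_ball' (by rw [dist_comm k h]; linarith)

theorem catFun_lt_iff {S : Set G} {h : G} {r : ℝ} :
    catFun S h < r ↔ 1 < r ∨ ¬ IsMeagre (S ∩ Metric.ball h r) :=
  catDist_lt_iff

theorem catFun_iUnion_lt_iff {S : ℕ → Set G} {h : G} {r : ℝ} :
    catFun (⋃ n, S n) h < r ↔ 1 < r ∨ ∃ n, catFun (S n) h < r := by
  simp only [catFun_lt_iff, iUnion_inter]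
  constructor
  · rintro (h1 | h1)
    · exact Or.inl h1
    · by_contra! hcon
      exact h1 (isMeagre_iUnion fun n => (hcon.2 n).2)
  · rintro (h1 | ⟨n, h1 | h1⟩)
    · exact Or.inl h1
    · exact Or.inl h1
    · exact Or.inr fun hm => h1 (hm.mono (subset_iUnion (fun n => S n ∩ Metric.ball h r) n))

theorem catFun_empty (h : G) : catFun (∅ : Set G) h = 1 := by
  refine le_antisymm ((catFun _).mem_Icc h).2 (le_of_not_gt fun hlt => ?_)
  rcases catFun_lt_iff.1 hlt with h1 | h1
  · exact lt_irrefl _ h1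
  · exact h1 (by rw [empty_inter]; exact IsMeagre.empty)

theorem catFun_congr {S T : Set G} (hST : S =ᶠ[residual G] T) : catFun S = catFun T := by
  have hle : ∀ {S T : Set G}, S =ᶠ[residual G] T → ∀ h, catFun S h ≤ catFun T h := by
    intro S T hST h
    refine le_of_forall_gt fun r hr => ?_
    rw [catFun_lt_iff] at hr ⊢
    refine hr.imp_right fun hn hm => hn ?_
    exact eventuallyEq_empty.1 ((hST.symm.inter EventuallyEq.rfl).trans (eventuallyEq_empty.2 hm))
  exact LipFun.ext (funext fun h => le_antisymm (hle hST h) (hle hST.symm h))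

theorem exists_isClosed_residualEq {S : Set G} (hS : BaireMeasurableSet S) :
    ∃ C : Set G, IsClosed C ∧ S =ᶠ[residual G] C := by
  obtain ⟨V, hV, hSV⟩ := hS.residualEq_isOpen
  exact ⟨closure V, isClosed_closure, hSV.trans (closure_residualEq hV.isLocallyClosed).symm⟩

variable [BaireSpace G]

theorem catFun_lt_iff_of_isOpen {V : Set G} (hV : IsOpen V) {h : G} {r : ℝ} :
    catFun V h < r ↔ 1 < r ∨ (V ∩ Metric.ball h r).Nonempty := by
  rw [catFun_lt_iff]
  exact or_congr_right ⟨nonempty_of_not_isMeagre,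
    not_isMeagre_of_isOpen (hV.inter Metric.isOpen_ball)⟩

/-- Modulo meagre sets `S` is an open `V`; the zero set is then `closure V`, which differs from `V`
by a nowhere dense set. Hence `catFun S` determines `S` modulo meagre sets. -/
theorem residualEq_setOf_catFun_le_zero {S : Set G} (hS : BaireMeasurableSet S) :
    S =ᶠ[residual G] {k | catFun S k ≤ 0} := by
  obtain ⟨V, hV, hSV⟩ := hS.residualEq_isOpen
  have hset : {k | catFun S k ≤ 0} = closure V := by
    ext k
    rw [catFun_congr hSV, mem_closure_iff_nhds_basis Metric.nhds_basis_ball]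
    constructor
    · intro hk ε hε
      rcases (catFun_lt_iff_of_isOpen hV).1
        ((show catFun V k ≤ 0 from hk).trans_lt (lt_min one_pos hε)) with h1 | ⟨y, hyV, hy⟩
      · exact absurd h1 (not_lt.2 (min_le_left _ _))
      · exact ⟨y, hyV, Metric.ball_subset_ball (min_le_right _ _) hy⟩
    · intro hk
      refine le_of_forall_gt fun ε hε => (catFun_lt_iff_of_isOpen hV).2 (Or.inr ?_)
      obtain ⟨y, hyV, hy⟩ := hk ε hε
      exact ⟨y, hyV, hy⟩
  rw [hset]
  exact hSV.trans (closure_residualEq hV.isLocallyClosed).symm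

theorem eventuallyEq_of_catFun_eq {S T : Set G} (hS : BaireMeasurableSet S)
    (hT : BaireMeasurableSet T) (hST : catFun S = catFun T) : S =ᶠ[residual G] T := by
  have h1 := residualEq_setOf_catFun_le_zero hS
  rw [hST] at h1
  exact h1.trans (residualEq_setOf_catFun_le_zero hT).symm

variable [SeparableSpace G] [Nonempty G]

/-- Replacing `S` by a closed set turns nonmeagreness of the complement into nonemptiness, which a
dense sequence detects. Complements are thus governed by countably many values of `catFun S`. -/
theorem catFun_compl_lt_iff {S : Set G} (hS : BaireMeasurableSet S) {h : G} {r : ℝ} :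
    catFun Sᶜ h < r ↔
      1 < r ∨ ∃ n, dist (denseSeq G n) h < r ∧ 0 < catFun S (denseSeq G n) := by
  obtain ⟨C, hC, hSC⟩ := exists_isClosed_residualEq hS
  rw [catFun_congr hSC, catFun_congr hSC.compl, catFun_lt_iff_of_isOpen hC.isOpen_compl]
  refine or_congr_right ⟨fun hne => ?_, ?_⟩
  · obtain ⟨_, hx, n, rfl⟩ := (denseRange_denseSeq G).inter_open_nonempty _
      (hC.isOpen_compl.inter Metric.isOpen_ball) hne
    refine ⟨n, hx.2, lt_of_not_ge fun hle => ?_⟩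
    obtain ⟨ε, hε, hsub⟩ := Metric.isOpen_iff.1 hC.isOpen_compl _ hx.1
    rcases catFun_lt_iff.1 (hle.trans_lt (lt_min one_pos hε)) with h1 | h1
    · exact absurd h1 (not_lt.2 (min_le_left _ _))
    · refine h1 (IsMeagre.mono (fun y hy => ?_) IsMeagre.empty)
      exact hsub (Metric.ball_subset_ball (min_le_right _ _) hy.2) hy.1
  · rintro ⟨n, hn, hpos⟩
    by_contra hne
    have hsub : Metric.ball h r ⊆ C := fun y hy => by
      by_contra hyC
      exact hne ⟨y, hyC, hy⟩
    have hle : catFun C (denseSeq G n) ≤ 0 := by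
      refine le_of_forall_gt fun ε hε => ?_
      refine catFun_lt_iff.2 (Or.inr fun hm => ?_)
      refine not_isMeagre_of_isOpen (Metric.isOpen_ball.inter Metric.isOpen_ball)
        ⟨denseSeq G n, Metric.mem_ball_self hε, Metric.mem_ball.2 hn⟩ (hm.mono ?_)
      exact fun y hy => ⟨hsub hy.2, hy.1⟩
    exact absurd hpos (not_lt.2 hle)

end Category

/-! ### Borel dependence on a parameter -/

section Measurability

variable {G : Type*} [PseudoMetricSpace G] [BaireSpace G] [SecondCountableTopology G] [Nonempty G]
  [MeasurableSpace G] [BorelSpace G]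

/-- Montgomery–Novikov: the category quantifier preserves Borel sets. -/
theorem measurable_catFun_preimage {Y : Type*} [MeasurableSpace Y] {S : Set (Y × G)}
    (hS : MeasurableSet S) : Measurable fun y => catFun (Prod.mk y ⁻¹' S) := by
  rw [LipFun.measurable_iff]
  have hgen := generateFrom_prod (α := Y) (β := G)
  rw [← hgen] at hS
  -- The claim is carried for all `h` at once, since the complement step uses the values at every
  -- point of the dense sequence.
  induction S, hS using MeasurableSpace.generateFrom_induction with
  | hC S hS _ =>
    obtain ⟨A, hA, V, -, rfl⟩ := hS
    intro h
    classical
    have : (fun y => catFun (Prod.mk y ⁻¹' A ×ˢ V) h) =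
        fun y => if y ∈ A then catFun V h else 1 := by
      funext y
      by_cases hy : y ∈ A
      · simp [mk_preimage_prod_right hy, hy]
      · simp [mk_preimage_prod_right_eq_empty hy, hy, catFun_empty]
    rw [this]
    exact Measurable.ite hA measurable_const measurable_const
  | empty => exact fun h => by simp
  | compl S hS ih =>
    intro h
    rw [hgen] at hS
    refine measurable_of_Iio fun r => ?_
    have hb : ∀ y, BaireMeasurableSet (Prod.mk y ⁻¹' S) := fun y =>
      (measurable_prodMk_left hS).baireMeasurableSet
    have : (fun y => catFun (Prod.mk y ⁻¹' Sᶜ) h) ⁻¹' Iio r =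
        {y | 1 < r ∨ ∃ n, dist (TopologicalSpace.denseSeq G n) h < r ∧
          0 < catFun (Prod.mk y ⁻¹' S) (TopologicalSpace.denseSeq G n)} := by
      ext y
      exact catFun_compl_lt_iff (hb y)
    rw [this]
    refine measurableSet_setOfPred.2 (measurable_const.or (Measurable.exists fun n =>
      measurable_const.and (measurableSet_setOfPred.1 ?_)))
    exact measurableSet_lt measurable_const (ih _)
  | iUnion S _ ih =>
    intro h
    refine measurable_of_Iio fun r => ?_
    have : (fun y => catFun (Prod.mk y ⁻¹' ⋃ n, S n) h) ⁻¹' Iio r =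
        {y | 1 < r ∨ ∃ n, catFun (Prod.mk y ⁻¹' S n) h < r} := by
      ext y
      rw [mem_preimage, preimage_iUnion]
      exact catFun_iUnion_lt_iff
    rw [this]
    refine measurableSet_setOfPred.2 (measurable_const.or (Measurable.exists fun n =>
      measurableSet_setOfPred.1 ?_))
    exact measurableSet_lt (ih n h) measurable_const

end Measurability

/-! ### Vaught transforms as an equivariant map -/

section VaughtMap

variable {G : Type*} [Group G] [PseudoMetricSpace G] {X : Type*} [MulAction G X]

/-- The Vaught transforms of `A` at `x`, coded by a Lipschitz function on the group. -/
noncomputable def vaughtMap (A : Set X) (x : X) : LipFun G := catFun {k : G | k • x ∈ A}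

/-- Right translation by `g` is an isometric homeomorphism, so it preserves both balls and
meagreness. -/
theorem vaughtMap_smul [IsTopologicalGroup G] [IsIsometricSMul Gᵐᵒᵖ G] (A : Set X) (g : G) (x : X) :
    vaughtMap A (g • x) = g • (vaughtMap A x : LipFun G) := by
  suffices key : ∀ h r, catFun {k : G | k • g • x ∈ A} h < r ↔
      catFun {k : G | k • x ∈ A} (h * g) < r from
    LipFun.ext (funext fun h => eq_of_forall_gt_iff (key h))
  intro h r
  rw [catFun_lt_iff, catFun_lt_iff]
  have hpre : {k : G | k • g • x ∈ A} ∩ Metric.ball h r =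
      Homeomorph.mulRight g ⁻¹' ({k : G | k • x ∈ A} ∩ Metric.ball (h * g) r) := by
    ext k
    simp [mul_smul]
  rw [hpre]
  refine or_congr_right (not_congr ⟨fun hm => ?_, fun hm => ?_⟩)
  · have := hm.preimage_of_isOpenMap (Homeomorph.mulRight g).symm.continuous
      (Homeomorph.mulRight g).symm.isOpenMap
    rwa [← preimage_comp, Homeomorph.self_comp_symm, preimage_id] at this
  · exact hm.preimage_of_isOpenMap (Homeomorph.mulRight g).continuous
      (Homeomorph.mulRight g).isOpenMap

variable [BaireSpace G]

theorem isOpen_vaughtMap_lt_of_isOpen [TopologicalSpace X] [ContinuousSMul G X] {A : Set X}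
    (hA : IsOpen A) (h : G) (r : ℝ) : IsOpen {x | (vaughtMap A x : LipFun G) h < r} := by
  have : {x | (vaughtMap A x : LipFun G) h < r} =
      {_x | 1 < r} ∪ ⋃ k ∈ Metric.ball h r, (k • · : X → X) ⁻¹' A := by
    ext x
    have hV : IsOpen {k : G | k • x ∈ A} := hA.preimage (continuous_id.smul continuous_const)
    refine (catFun_lt_iff_of_isOpen hV).trans ?_
    simp [Set.Nonempty, and_comm]
  rw [this]
  exact isOpen_const.union (isOpen_biUnion fun k _ => hA.preimage (continuous_const_smul k))

variable [SecondCountableTopology G]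

theorem isOpen_vaughtMap_compl_lt [TopologicalSpace X] {A : Set X}
    (hA : ∀ x, BaireMeasurableSet {k : G | k • x ∈ A})
    (hc : Continuous (vaughtMap A : X → LipFun G)) (h : G) (r : ℝ) :
    IsOpen {x | (vaughtMap Aᶜ x : LipFun G) h < r} := by
  have : {x | (vaughtMap Aᶜ x : LipFun G) h < r} =
      {_x | 1 < r} ∪ ⋃ n, {_x | dist (TopologicalSpace.denseSeq G n) h < r} ∩
        {x | 0 < (vaughtMap A x : LipFun G) (TopologicalSpace.denseSeq G n)} := by
    ext x
    refine (catFun_compl_lt_iff (hA x)).trans ?_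
    simp [vaughtMap]
  rw [this]
  exact isOpen_const.union (isOpen_iUnion fun n => isOpen_const.inter
    (isOpen_lt continuous_const (LipFun.continuous_iff.1 hc _)))

omit [BaireSpace G] [SecondCountableTopology G] in
theorem isOpen_vaughtMap_iUnion_lt [TopologicalSpace X] {A : ℕ → Set X}
    (hc : ∀ n, Continuous (vaughtMap (A n) : X → LipFun G)) (h : G) (r : ℝ) :
    IsOpen {x | (vaughtMap (⋃ n, A n) x : LipFun G) h < r} := by
  have : {x | (vaughtMap (⋃ n, A n) x : LipFun G) h < r} =
      {_x | 1 < r} ∪ ⋃ n, {x | (vaughtMap (A n) x : LipFun G) h < r} := by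
    ext x
    have hU : {k : G | k • x ∈ ⋃ n, A n} = ⋃ n, {k : G | k • x ∈ A n} := by
      ext k
      simp
    rw [mem_ofPred_eq, vaughtMap, hU, catFun_iUnion_lt_iff]
    simp [vaughtMap]
  rw [this]
  exact isOpen_const.union (isOpen_iUnion fun n =>
    isOpen_lt (LipFun.continuous_iff.1 (hc n) _) continuous_const)

end VaughtMap

/-! ### Refining a Polish `G`-topology -/

section Refinement

open TopologicalSpace

variable {G : Type*} [Group G] [PseudoMetricSpace G] [IsTopologicalGroup G]
  [IsIsometricSMul Gᵐᵒᵖ G] [SecondCountableTopology G]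
  {Y : Type*} [MulAction G Y]

omit [IsTopologicalGroup G] [IsIsometricSMul Gᵐᵒᵖ G] [SecondCountableTopology G] in
/-- A Polish `G`-space topology pulls back along an equivariant injection with `Gδ` range. -/
theorem exists_polish_continuousSMul_of_injective {Z : Type*} [s : TopologicalSpace Z]
    [PolishSpace Z] [MulAction G Z] [ContinuousSMul G Z] {f : Y → Z} (hf : Function.Injective f)
    (hsmul : ∀ (g : G) y, f (g • y) = g • f y) (hr : IsGδ (range f)) :
    ∃ t : TopologicalSpace Y, t = s.induced f ∧ @PolishSpace Y t ∧
      @ContinuousSMul G Y _ _ t := by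
  let := s.induced f
  have hi : IsInducing f := ⟨rfl⟩
  exact ⟨_, rfl, polishSpace_induced_of_isGδ_range hf hr,
    hi.continuousSMul continuous_id fun {g y} => hsmul g y⟩

/-- The graph of an equivariant upper semicontinuous map is a Polish `G`-space. -/
theorem exists_finer_of_upperSemicontinuous [t : TopologicalSpace Y] [PolishSpace Y]
    [ContinuousSMul G Y] {F : Y → LipFun G} (hF : ∀ (g : G) y, F (g • y) = g • F y)
    (husc : ∀ h r, IsOpen {y | F y h < r}) :
    ∃ t' ≤ t, @PolishSpace Y t' ∧ @ContinuousSMul G Y _ _ t' ∧ Continuous[t', _] F := by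
  let Γ : Y → Y × LipFun G := fun y => (y, F y)
  have hGδ : IsGδ (range Γ) := by
    have hopen : ∀ h (a : ℝ), IsOpen {p : Y × LipFun G | F p.1 h < p.2 h + a} := fun h a => by
      have : {p : Y × LipFun G | F p.1 h < p.2 h + a} =
          ⋃ q : ℝ, {p | F p.1 h < q} ∩ {p | q < p.2 h + a} := by
        ext p
        simp only [mem_iUnion]
        exact ⟨fun hp => exists_between (show F p.1 h < p.2 h + a from hp), fun ⟨q, h1, h2⟩ =>
          lt_trans (b := q) h1 h2⟩
      rw [this]
      exact isOpen_iUnion fun q => ((husc h q).preimage continuous_fst).inter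
        (isOpen_lt continuous_const
          (((LipFun.continuous_eval h).comp continuous_snd).add continuous_const))
    have hclosed : ∀ h, IsClosed {p : Y × LipFun G | p.2 h ≤ F p.1 h} := fun h => by
      have := hopen h 0
      simp only [add_zero] at this
      convert! this.isClosed_compl using 1
      ext p
      simp
    -- Upper semicontinuity makes one inequality closed and the strict approximations to the other
    -- open; a dense sequence keeps the latter countable.
    have hr : range Γ = (⋂ h, {p | p.2 h ≤ F p.1 h}) ∩
        ⋂ n : ℕ, ⋂ m : ℕ, {p | F p.1 (denseSeq G n) < p.2 (denseSeq G n) + 1 / ((m : ℝ) + 1)} := by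
      ext ⟨y, φ⟩
      simp only [mem_range, mem_inter_iff, mem_iInter, mem_ofPred_eq, Γ, Prod.mk.injEq]
      constructor
      · rintro ⟨_, rfl, rfl⟩
        exact ⟨fun h => le_rfl, fun n m => lt_add_of_pos_right _ (by positivity)⟩
      · rintro ⟨h1, h2⟩
        refine ⟨y, rfl, LipFun.ext ?_⟩
        refine Continuous.ext_on (denseRange_denseSeq G) (F y).continuous φ.continuous ?_
        rintro _ ⟨n, rfl⟩
        refine le_antisymm (le_of_forall_pos_lt_add' fun ε hε => ?_) (h1 _)
        obtain ⟨m, hm⟩ := exists_nat_one_div_lt hε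
        have := h2 n m
        linarith
    rw [hr]
    exact (isClosed_iInter hclosed).isGδ.inter
      (IsGδ.iInter fun n => IsGδ.iInter fun m => (hopen _ _).isGδ)
  have hle : instTopologicalSpaceProd.induced Γ ≤ t :=
    (induced_mono (continuous_fst (Y := LipFun G)).le_induced).trans_eq
      (induced_compose.trans induced_id)
  have hFc : Continuous[instTopologicalSpaceProd.induced Γ, _] F :=
    continuous_iff_le_induced.2
      ((induced_mono (continuous_snd (X := Y)).le_induced).trans_eq induced_compose)
  obtain ⟨t', rfl, hP, hS⟩ := exists_polish_continuousSMul_of_injective (G := G) (f := Γ)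
    (fun x y h => congrArg Prod.fst h) (fun g y => Prod.ext rfl (hF g y)) hGδ
  exact ⟨_, hle, hP, hS, hFc⟩

end Refinement

/-! ### The Becker–Kechris theorem -/

section BeckerKechris

variable {G : Type*} [Group G] [PseudoMetricSpace G] [IsTopologicalGroup G]
  [IsIsometricSMul Gᵐᵒᵖ G] [SecondCountableTopology G] [BaireSpace G]

section PolishSpace

variable {Y : Type*} [MulAction G Y]

theorem exists_finer_continuous_vaughtMap_compl [t : TopologicalSpace Y] [PolishSpace Y]
    [ContinuousSMul G Y] {A : Set Y} (hA : ∀ y, BaireMeasurableSet {k : G | k • y ∈ A})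
    (hc : Continuous (vaughtMap A : Y → LipFun G)) :
    ∃ t' ≤ t, @PolishSpace Y t' ∧ @ContinuousSMul G Y _ _ t' ∧
      Continuous[t', _] (vaughtMap Aᶜ : Y → LipFun G) :=
  exists_finer_of_upperSemicontinuous (vaughtMap_smul _) (isOpen_vaughtMap_compl_lt hA hc)

omit [BaireSpace G] in
theorem exists_finer_continuous_vaughtMap_iUnion [t : TopologicalSpace Y] [PolishSpace Y]
    [ContinuousSMul G Y] {A : ℕ → Set Y}
    (hc : ∀ n, Continuous (vaughtMap (A n) : Y → LipFun G)) :
    ∃ t' ≤ t, @PolishSpace Y t' ∧ @ContinuousSMul G Y _ _ t' ∧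
      Continuous[t', _] (vaughtMap (⋃ n, A n) : Y → LipFun G) :=
  exists_finer_of_upperSemicontinuous (vaughtMap_smul _) (isOpen_vaughtMap_iUnion_lt hc)

omit [IsTopologicalGroup G] [IsIsometricSMul Gᵐᵒᵖ G] [SecondCountableTopology G] [BaireSpace G] in
theorem exists_common_finer [t : TopologicalSpace Y] [PolishSpace Y] [ContinuousSMul G Y]
    {s : ℕ → TopologicalSpace Y} (hs : ∀ n, s n ≤ t) (hP : ∀ n, @PolishSpace Y (s n))
    (hS : ∀ n, @ContinuousSMul G Y _ _ (s n)) :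
    ∃ t' ≤ t, (∀ n, t' ≤ s n) ∧ @PolishSpace Y t' ∧ @ContinuousSMul G Y _ _ t' :=
  -- Index `none` adds `t` itself, the common coarser topology needed for the join to be Polish.
  ⟨⨅ i : Option ℕ, i.elim t s, iInf_le _ none, fun n => iInf_le _ (some n),
    .iInf ⟨none, Option.forall.2 ⟨le_rfl, hs⟩⟩ (Option.forall.2 ⟨‹_›, hP⟩),
    continuousSMul_iInf (Option.forall.2 ⟨‹_›, hS⟩)⟩

/-- At each Borel operation, continuity of the earlier Vaught maps makes the new one upper
semicontinuous; passing to its graph makes it continuous. -/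
theorem exists_finer_continuous_vaughtMap [t : TopologicalSpace Y] [PolishSpace Y]
    [MeasurableSpace Y] [BorelSpace Y] [ContinuousSMul G Y] {A : Set Y} (hA : MeasurableSet A) :
    ∃ t' ≤ t, @PolishSpace Y t' ∧ @ContinuousSMul G Y _ _ t' ∧
      Continuous[t', _] (vaughtMap A : Y → LipFun G) := by
  induction A, hA using MeasurableSet.induction_on_open with
  | isOpen U hU =>
    exact exists_finer_of_upperSemicontinuous (vaughtMap_smul _) (isOpen_vaughtMap_lt_of_isOpen hU)
  | compl A hA ih =>
    have hb : ∀ y, BaireMeasurableSet {k : G | k • y ∈ A} := fun y => by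
      borelize G
      exact ((continuous_id.smul continuous_const : Continuous fun k : G => k • y).measurable
        hA).baireMeasurableSet
    obtain ⟨s, hs, hP, hS, hc⟩ := ih
    obtain ⟨t', ht', h⟩ := @exists_finer_continuous_vaughtMap_compl G _ _ _ _ _ _ Y _ s hP hS A hb hc
    exact ⟨t', ht'.trans hs, h⟩
  | iUnion A _ _ ih =>
    choose s hs hP hS hc using ih
    obtain ⟨s', hs', hle, hP', hS'⟩ := exists_common_finer (G := G) hs hP hS
    obtain ⟨t', ht', h⟩ := @exists_finer_continuous_vaughtMap_iUnion G _ _ _ _ _ Y _ s' hP' hS' A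
      fun n => continuous_le_dom (hle n) (hc n)
    exact ⟨t', ht'.trans hs', h⟩

omit [IsTopologicalGroup G] [IsIsometricSMul Gᵐᵒᵖ G] [SecondCountableTopology G] in
theorem setOf_vaughtMap_lt_of_isInvariant {A : Set Y} (hA : IsInvariant G A) :
    {y | (vaughtMap A y : LipFun G) 1 < 1} = A := by
  ext y
  rw [mem_ofPred_eq, vaughtMap]
  by_cases hy : y ∈ A
  · have : {k : G | k • y ∈ A} = univ := eq_univ_of_forall fun k => hA k y hy
    rw [this, catFun_lt_iff_of_isOpen isOpen_univ]
    exact iff_of_true (Or.inr ⟨1, trivial, Metric.mem_ball_self one_pos⟩) hy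
  · have : {k : G | k • y ∈ A} = ∅ := eq_empty_of_forall_notMem fun k hk =>
      hy (by simpa using hA k⁻¹ _ hk)
    rw [this, catFun_empty]
    exact iff_of_false (lt_irrefl _) hy

/-- An invariant Borel set in a Polish `G`-space is open in a finer Polish `G`-space topology. -/
theorem exists_finer_isOpen_of_isInvariant [t : TopologicalSpace Y] [PolishSpace Y]
    [MeasurableSpace Y] [BorelSpace Y] [ContinuousSMul G Y] {A : Set Y} (hA : MeasurableSet A)
    (hinv : IsInvariant G A) :
    ∃ t' ≤ t, @PolishSpace Y t' ∧ @ContinuousSMul G Y _ _ t' ∧ IsOpen[t'] A := by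
  obtain ⟨t', hle, hP, hS, hc⟩ := exists_finer_continuous_vaughtMap (G := G) hA
  refine ⟨t', hle, hP, hS, ?_⟩
  rw [← setOf_vaughtMap_lt_of_isInvariant hinv]
  exact (isOpen_Iio (a := (1 : ℝ))).preimage ((LipFun.continuous_eval (1 : G)).comp hc)

end PolishSpace

variable [MeasurableSpace G] [BorelSpace G]

omit [IsTopologicalGroup G] [IsIsometricSMul Gᵐᵒᵖ G] in
theorem measurable_vaughtMap {X : Type*} [MeasurableSpace X] [MulAction G X] [MeasurableSMul₂ G X]
    {A : Set X} (hA : MeasurableSet A) : Measurable (vaughtMap A : X → LipFun G) :=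
  measurable_catFun_preimage (S := (fun p : X × G => p.2 • p.1) ⁻¹' A)
    ((measurable_snd.smul measurable_fst) hA)

omit [IsTopologicalGroup G] [IsIsometricSMul Gᵐᵒᵖ G] [SecondCountableTopology G] in
-- For comeagrely many `k`, no `A n` separates `k • x` from `k • y`; by Baire category one such `k`
-- exists, and it can be cancelled.
theorem eq_of_vaughtMap_eq {X : Type*} [MeasurableSpace X] [MulAction G X] [MeasurableSMul₂ G X]
    {A : ℕ → Set X} (hA : ∀ n, MeasurableSet (A n))
    (hsep : ∀ x y, (∀ n, x ∈ A n ↔ y ∈ A n) → x = y) {x y : X}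
    (h : ∀ n, (vaughtMap (A n) x : LipFun G) = vaughtMap (A n) y) : x = y := by
  have hb : ∀ n x, BaireMeasurableSet {k : G | k • x ∈ A n} := fun n x =>
    (measurable_smul_const x (hA n)).baireMeasurableSet
  have hev : ∀ᶠ k in residual G, ∀ n, k • x ∈ A n ↔ k • y ∈ A n :=
    eventually_countable_forall.2 fun n =>
      eventuallyEq_set.1 (eventuallyEq_of_catFun_eq (hb n x) (hb n y) (h n))
  obtain ⟨k, hk⟩ := (dense_of_mem_residual hev).nonempty
  exact smul_left_cancel k (hsep _ _ hk)

/-- Becker–Kechris, for a group with a right-invariant metric. -/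
theorem exists_polish_borel_continuousSMul_of_isIsometricSMul (X : Type*) [m : MeasurableSpace X]
    [StandardBorelSpace X] [MulAction G X] [MeasurableSMul₂ G X] :
    ∃ t : TopologicalSpace X, @PolishSpace X t ∧ @BorelSpace X t m ∧ @ContinuousSMul G X _ _ t := by
  obtain ⟨A, hA, hsep⟩ := exists_seq_separating X (p := MeasurableSet) MeasurableSet.empty univ
  let F : X → ℕ → LipFun G := fun x n => vaughtMap (A n) x
  have hinj : Function.Injective F := fun x y h =>
    eq_of_vaughtMap_eq hA (fun x y => hsep x trivial y trivial) (congrFun h)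
  have hmeas : Measurable F := measurable_pi_iff.2 fun n => measurable_vaughtMap (hA n)
  have hsmul : ∀ (g : G) x, F (g • x) = g • F x := fun g x =>
    funext fun n => vaughtMap_smul (A n) g x
  -- Lusin–Souslin: injective Borel images are Borel.
  have hemb : MeasurableEmbedding F := hmeas.measurableEmbedding hinj
  have hinv : IsInvariant G (range F) := by
    rintro g _ ⟨x, rfl⟩
    exact ⟨g • x, hsmul g x⟩
  have hpol : PolishSpace (ℕ → LipFun G) := inferInstance
  have hbor : (MeasurableSpace.pi : MeasurableSpace (ℕ → LipFun G)) = borel _ :=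
    BorelSpace.measurable_eq
  obtain ⟨s, hle, hP, hS, ho⟩ := exists_finer_isOpen_of_isInvariant hemb.measurableSet_range hinv
  obtain ⟨t, rfl, hPt, hSt⟩ := @exists_polish_continuousSMul_of_injective G _ _ X _ (ℕ → LipFun G) s
    hP _ hS F hinj hsmul (@IsOpen.isGδ _ s _ ho)
  refine ⟨_, hPt, @BorelSpace.mk _ (_) _ ?_, hSt⟩
  -- Comparable Polish topologies have the same Borel sets.
  rw [← hemb.comap_eq, hbor, ← borel_eq_borel_of_le hP hpol hle, borel_comap]

end BeckerKechris

section PolishGroup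

variable (G : Type*) [Group G] [τ : TopologicalSpace G] [IsTopologicalGroup G] [PolishSpace G]
  [MeasurableSpace G] [BorelSpace G]

/-- Becker–Kechris: every Borel `G`-space is Borel isomorphic to a Polish `G`-space. -/
theorem exists_polish_borel_continuousSMul (X : Type*) [m : MeasurableSpace X]
    [StandardBorelSpace X] [MulAction G X] [MeasurableSMul₂ G X] :
    ∃ t : TopologicalSpace X, @PolishSpace X t ∧ @BorelSpace X t m ∧ @ContinuousSMul G X _ _ t := by
  have hB : BaireSpace G := inferInstance
  obtain ⟨I, rfl, hI⟩ := exists_rightInvariant_pseudoMetricSpace G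
  have : IsIsometricSMul Gᵐᵒᵖ G :=
    ⟨fun c => Isometry.of_dist_eq fun x y => hI x y c.unop⟩
  exact exists_polish_borel_continuousSMul_of_isIsometricSMul X

end PolishGroup

/-! ### Perfect subsets of uncountable Borel sets -/

theorem not_countable_range_of_injective {X : Type*} {f : (ℕ → Bool) → X}
    (hf : Function.Injective f) : ¬ (range f).Countable := fun h => by
  have := h.to_subtype
  have : Countable (ℕ → Bool) := (hf.codRestrict mem_range_self).countable
  obtain ⟨e, he⟩ := exists_surjective_nat (ℕ → Bool)
  obtain ⟨n, hn⟩ := he fun n => !e n n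
  simpa using congrFun hn n

/-- A finer Polish topology makes `S` closed, so Cantor space injects into it; the image is compact
in the original topology, where Cantor–Bendixson applies. -/
theorem exists_perfect_subset {X : Type*} [TopologicalSpace X] [PolishSpace X] [MeasurableSpace X]
    [BorelSpace X] {S : Set X} (hS : MeasurableSet S) (hunc : ¬ S.Countable) :
    ∃ P ⊆ S, P.Nonempty ∧ Perfect P := by
  obtain ⟨f, hfS, hf, hinj⟩ : ∃ f : (ℕ → Bool) → X, range f ⊆ S ∧ Continuous f ∧
      Function.Injective f := by
    obtain ⟨t', hle, hP, hc, -⟩ := hS.isClopenable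
    obtain ⟨f, hfS, hf, hinj⟩ := @IsClosed.exists_nat_bool_injection_of_not_countable X t' hP S hc hunc
    exact ⟨f, hfS, continuous_le_rng hle hf, hinj⟩
  obtain ⟨P, hP, hne, hsub⟩ := exists_perfect_nonempty_of_isClosed_of_not_countable
    (isCompact_range hf).isClosed (not_countable_range_of_injective hinj)
  exact ⟨P, hsub.trans hfS, hne, hP⟩

theorem not_countable_of_perfect {X : Type*} [TopologicalSpace X] [PolishSpace X] {P : Set X}
    (hP : Perfect P) (hne : P.Nonempty) : ¬ P.Countable := fun h => by
  let := TopologicalSpace.upgradeIsCompletelyMetrizable X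
  obtain ⟨f, hfP, -, hinj⟩ := hP.exists_nat_bool_injection hne
  exact not_countable_range_of_injective hinj (h.mono hfP)

/-! ### The three implications -/

section Equivalence

variable {G : Type u} [Group G] [TopologicalSpace G]

theorem TVC_I.tvc_II (h : TVC_I.{u, v} G) : TVC_II.{u, v} G := by
  intro X _ _ _ _
  borelize X
  exact (h X univ MeasurableSet.univ fun _ _ _ => trivial).imp_right
    fun ⟨P, _, hne, hP, hO⟩ => ⟨P, hne, hP, hO⟩

variable [IsTopologicalGroup G] [PolishSpace G] [MeasurableSpace G] [BorelSpace G]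

theorem TVC_II.tvc_III (h : TVC_II.{u, v} G) : TVC_III.{u, v} G := by
  intro X _ _ _ _
  obtain ⟨t, hP, hB, hS⟩ := exists_polish_borel_continuousSMul G X
  exact (h X).imp_right fun ⟨P, hne, hP, hO⟩ =>
    ⟨P, hP.closed.measurableSet, not_countable_of_perfect hP hne, hO⟩

omit [IsTopologicalGroup G] [PolishSpace G] in
theorem TVC_III.tvc_I (h : TVC_III.{u, v} G) : TVC_I.{u, v} G := by
  intro X _ _ _ _ _ _ B hB hinv
  let _ : MulAction G B :=
    { smul g x := ⟨g • x.1, hinv g x.1 x.2⟩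
      one_smul x := Subtype.ext (one_smul G x.1)
      mul_smul g g' x := Subtype.ext (mul_smul g g' x.1) }
  have hcoe : ∀ (g : G) (x : B), ((g • x : B) : X) = g • (x : X) := fun _ _ => rfl
  have : StandardBorelSpace B := hB.standardBorel
  have : MeasurableSMul₂ G B :=
    ⟨((measurable_fst.smul (measurable_subtype_coe.comp measurable_snd) :
      Measurable fun p : G × B => p.1 • (p.2 : X))).subtype_mk⟩
  have horb : ∀ x : B, MulAction.orbit G (x : X) = Subtype.val '' MulAction.orbit G x := fun x => by
    ext y
    constructor
    · rintro ⟨g, rfl⟩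
      exact ⟨g • x, ⟨g, rfl⟩, rfl⟩
    · rintro ⟨_, ⟨g, rfl⟩, rfl⟩
      exact ⟨g, rfl⟩
  rcases h B with hc | ⟨P, hP, hunc, hO⟩
  · left
    refine (hc.image fun O => Subtype.val '' O).mono ?_
    rintro _ ⟨x, hx, rfl⟩
    exact ⟨_, ⟨⟨x, hx⟩, trivial, rfl⟩, (horb ⟨x, hx⟩).symm⟩
  · right
    obtain ⟨Q, hQ, hne, hQp⟩ := exists_perfect_subset (hB.subtype_image hP)
      (fun hc => hunc ((mapsTo_image _ _).countable_of_injOn Subtype.val_injective.injOn hc))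
    refine ⟨Q, fun x hx => ?_, hne, hQp, fun x hx y hy hxy he => ?_⟩
    · obtain ⟨z, -, rfl⟩ := hQ hx
      exact z.2
    · obtain ⟨x, hxP, rfl⟩ := hQ hx
      obtain ⟨y, hyP, rfl⟩ := hQ hy
      rw [horb, horb] at he
      exact hO x hxP y hyP (fun h => hxy (congrArg _ h))
        (Subtype.val_injective.image_injective he)

end Equivalence

end Vaught

theorem corollary1p3 (G : Type u) [Group G] [TopologicalSpace G] [IsTopologicalGroup G]
    [PolishSpace G] [MeasurableSpace G] [BorelSpace G] :
    (Vaught.TVC_I.{u, v} G ↔ Vaught.TVC_II.{u, v} G) ∧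
      (Vaught.TVC_II.{u, v} G ↔ Vaught.TVC_III.{u, v} G) :=
  ⟨⟨Vaught.TVC_I.tvc_II, fun h => h.tvc_III.tvc_I⟩, Vaught.TVC_II.tvc_III, fun h => h.tvc_I.tvc_II⟩
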